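/- Let $p$ be a prime number, and let $G$ be a topologically finitely generated group, i.e. a topological group with a finite subset that generates a dense subgroup. For a positive integer $n$, let $\mathrm{Hom}(G,S_n)$ be the set of continuous group homomorphisms from $G$ to the symmetric group $S_n$ with the discrete topology. For every positive integer $n$, the set $\mathrm{Hom}(G,S_n)$ and the set of open subgroups of $G$ of index $n$ are finite. The function $n \mapsto \#\mathrm{Hom}(G,S_n)$ on the positive integers extends to a continuous function $\mathbb{Z}_p \to \mathbb{Q}_p$ if and only if $p$ divides the number of open subgroups of $G$ of index $p$. In particular, if $G$ is a finite topological group (for example a finite group with the discrete topology) of order prime to $p$, then $n \mapsto \#\mathrm{Hom}(G,S_n)$ extends to a continuous function $\mathbb{Z}_p \to \mathbb{Q}_p$. -/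

import Mathlib

/-- A topological group is topologically finitely generated if some finite subset generates a
dense subgroup. -/
def IsTopologicallyFG (G : Type*) [Group G] [TopologicalSpace G] : Prop :=
  ∃ S : Finset G, Dense (Subgroup.closure (S : Set G) : Set G)

/-- The set of continuous homomorphisms from `G` to the symmetric group on `n` letters, where the
latter carries the discrete topology `⊥`. -/
def contHomSym (G : Type*) [Group G] [TopologicalSpace G] (n : ℕ) :
    Set (G →* Equiv.Perm (Fin n)) :=
  {φ | @Continuous G (Equiv.Perm (Fin n)) _ ⊥ φ}

/-- The set of open subgroups of `G` of index `n`. -/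
def openSubgroupsOfIndex (G : Type*) [Group G] [TopologicalSpace G] (n : ℕ) :
    Set (Subgroup G) :=
  {H | IsOpen (H : Set G) ∧ H.index = n}

/-- A function on the positive integers (given as a function on `ℕ` whose value at `0` is ignored)
extends to a continuous function from the `p`-adic integers to the `p`-adic numbers. -/
def ExtendsToPadic (p : ℕ) [Fact p.Prime] (f : ℕ → ℕ) : Prop :=
  ∃ F : ℤ_[p] → ℚ_[p], Continuous F ∧ ∀ n : ℕ, 0 < n → F (n : ℤ_[p]) = (f n : ℚ_[p])

/-! Write h(n) for the number of continuous homomorphisms to S_n and s(d) for the number of open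
subgroups of index d. Counting pairs (action on n points, chosen point) by the stabilizer of the
point gives n h(n) = ∑ s(d) n!/(n-d)! h(n-d) (`mul_ncard_contHomSym`). Equivalently H = ∑ h(n)
X^n/n! satisfies X H'/H = ∑ s(d) X^d, so H = exp(∑ s(d) X^d/d).

By Mahler's theorem, continuity of the interpolation concerns the decay of the numbers k! [X^k] of H
e^{-X} = exp(∑_{d ≥ 2} s(d) X^d/d), where s(1) = 1 has been cancelled. Every factor with d ≠ p has
coefficients growing more slowly than 1/|k!|; the factor d = p does too when p divides s(p)
(`norm_coeff_expMonomial_le`, `tendsto_norm_factorial_mul_pow`). Hence p ∣ s(p) suffices.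

Conversely, if an extension exists, dividing out the harmless factors isolates exp(s(p) X^p/p). For
s(p) prime to p its exponential coefficients at multiples of p are units
(`norm_egfCoeff_expMonomial_prime`), contradicting decay. The extension need not take the value h(0)
= 1 at 0, so that discrepancy must first be shown to vanish. -/

/-! ### Permutation actions, point stabilizers and the recurrence. -/

section OpenStabilizers

open Equiv

/-- The homomorphisms from `G` to the permutations of `α` all of whose point stabilizers are open. -/
def OpenStabHom (G α : Type*) [Group G] [TopologicalSpace G] : Type _ :=
  {φ : G →* Perm α // ∀ x, IsOpen {g | φ g x = x}}

/-- The members of `OpenStabHom G α` that extend the translation action of `G` on `G ⧸ H`,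
transported along an embedding `j`. -/
def ExtendsCosets {G α : Type*} [Group G] [TopologicalSpace G] {H : Subgroup G}
    (j : G ⧸ H ↪ α) (φ : OpenStabHom G α) : Prop :=
  ∀ (g : G) (q : G ⧸ H), φ.1 g (j q) = j (g • q)

section OpenStabHom

variable {G : Type*} [Group G] [TopologicalSpace G]

/-- On a finite set the kernel is a finite intersection of point stabilizers. The pointwise
condition is easier to restrict to invariant subsets and to glue. -/
theorem continuous_bot_iff_isOpen_stabilizers [IsTopologicalGroup G] {α : Type*} [Finite α]
    (φ : G →* Perm α) :
    @Continuous G (Perm α) _ ⊥ φ ↔ ∀ x, IsOpen {g | φ g x = x} := by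
  let _ : TopologicalSpace (Perm α) := ⊥
  have : DiscreteTopology (Perm α) := ⟨rfl⟩
  constructor
  · intro h x
    exact (isOpen_discrete {σ : Perm α | σ x = x}).preimage h
  · intro h
    refine continuous_of_continuousAt_one φ ?_
    rw [ContinuousAt, map_one, nhds_discrete (Perm α), Filter.tendsto_pure]
    have h1 : IsOpen (⋂ x, {g | φ g x = x}) := isOpen_iInter_of_finite h
    filter_upwards [h1.mem_nhds (by simp)] with g hg
    ext x
    exact Set.mem_iInter.1 hg x

theorem card_openStabHom_congr {α β : Type*} (e : α ≃ β) :
    Nat.card (OpenStabHom G α) = Nat.card (OpenStabHom G β) := by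
  refine Nat.card_congr
    { toFun := fun φ => ⟨(e.permCongrHom : Perm α →* Perm β).comp φ.1, fun x => ?_⟩
      invFun := fun φ => ⟨(e.symm.permCongrHom : Perm β →* Perm α).comp φ.1, fun x => ?_⟩
      left_inv := fun φ => ?_
      right_inv := fun φ => ?_ }
  · convert φ.2 (e.symm x) using 3
    simp [Equiv.permCongrHom, Equiv.eq_symm_apply]
  · convert φ.2 (e x) using 3
    simp [Equiv.permCongrHom, Equiv.symm_apply_eq]
  · apply Subtype.ext; ext g x; simp [Equiv.permCongrHom]
  · apply Subtype.ext; ext g x; simp [Equiv.permCongrHom]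

theorem isOpen_stabilizer_coset [IsTopologicalGroup G] {H : Subgroup G}
    (hH : IsOpen (H : Set G)) (q : G ⧸ H) : IsOpen {g : G | g • q = q} := by
  induction q using QuotientGroup.induction_on with
  | H x =>
    have : {g : G | g • (x : G ⧸ H) = x} = (fun g => x⁻¹ * g * x) ⁻¹' H := by
      ext g
      have h1 : g • (x : G ⧸ H) = ((g * x : G) : G ⧸ H) := rfl
      simp only [Set.mem_ofPred_eq, Set.mem_preimage, SetLike.mem_coe, h1]
      rw [eq_comm, QuotientGroup.eq, mul_assoc]
    rw [this]
    exact hH.preimage (by fun_prop)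

-- The action on the image of `j` is prescribed, so this image and its complement are invariant. An
-- extension is therefore a free choice of action on the complement.
open scoped Classical in
theorem card_extendsCosets [IsTopologicalGroup G] {α : Type*} {H : Subgroup G}
    (hH : IsOpen (H : Set G)) (j : G ⧸ H ↪ α) :
    Nat.card {φ : OpenStabHom G α // ExtendsCosets j φ} =
      Nat.card (OpenStabHom G {a // a ∉ Set.range j}) := by
  let e : G ⧸ H ≃ {a // a ∈ Set.range j} := Equiv.ofInjective j j.injective
  let τ : G →* Perm {a // a ∈ Set.range j} :=
    (e.permCongrHom : Perm (G ⧸ H) →* Perm _).comp (MulAction.toPermHom G (G ⧸ H))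
  have hτ : ∀ g q, (τ g ⟨j q, q, rfl⟩ : α) = j (g • q) := by
    intro g q
    have : (⟨j q, q, rfl⟩ : {a // a ∈ Set.range j}) = e q := rfl
    rw [this]
    simp only [τ, MonoidHom.comp_apply]
    simp [Equiv.permCongrHom, e]
  have hpres : ∀ φ : OpenStabHom G α, ExtendsCosets j φ →
      ∀ (g : G) a, φ.1 g a ∉ Set.range j ↔ a ∉ Set.range j := by
    intro φ hφ g a
    rw [not_iff_not]
    constructor
    · rintro ⟨q, hq⟩
      refine ⟨g⁻¹ • q, ?_⟩
      rw [← hφ, hq, ← Perm.mul_apply, ← map_mul]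
      simp
    · rintro ⟨q, rfl⟩
      exact ⟨g • q, (hφ g q).symm⟩
  refine Nat.card_congr
    { toFun := fun φ => ⟨
        { toFun := fun g => (φ.1.1 g).subtypePerm (hpres φ.1 φ.2 g)
          map_one' := by ext x; simp
          map_mul' := fun g h => by ext x; rw [Perm.coe_mul]; simp [Perm.subtypePerm_apply] }, fun x => ?_⟩
      invFun := fun ψ => ⟨⟨(Perm.subtypeCongrHom (· ∈ Set.range j)).comp (τ.prod ψ.1),
        fun x => ?_⟩, fun g q => ?_⟩
      left_inv := fun φ => ?_
      right_inv := fun ψ => ?_ }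
  · convert φ.1.2 x.1 using 3
    simp [Subtype.ext_iff]
  · by_cases hx : x ∈ Set.range j
    · obtain ⟨q, rfl⟩ := hx
      convert isOpen_stabilizer_coset hH q using 3 with g
      simp only [MonoidHom.comp_apply, MonoidHom.prod_apply, Perm.subtypeCongrHom_apply]
      rw [Perm.subtypeCongr.left_apply _ _ ⟨q, rfl⟩, hτ, j.injective.eq_iff]
    · convert ψ.2 ⟨x, hx⟩ using 3 with g
      simp only [MonoidHom.comp_apply, MonoidHom.prod_apply, Perm.subtypeCongrHom_apply]
      rw [Perm.subtypeCongr.right_apply _ _ hx, Subtype.ext_iff]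
  · simp only [MonoidHom.comp_apply, MonoidHom.prod_apply, Perm.subtypeCongrHom_apply]
    rw [Perm.subtypeCongr.left_apply _ _ ⟨q, rfl⟩, hτ]
  · apply Subtype.ext; apply Subtype.ext; ext g x
    simp only [MonoidHom.comp_apply, MonoidHom.prod_apply, Perm.subtypeCongrHom_apply]
    by_cases hx : x ∈ Set.range j
    · obtain ⟨q, rfl⟩ := hx
      rw [Perm.subtypeCongr.left_apply _ _ ⟨q, rfl⟩, hτ, φ.2]
    · rw [Perm.subtypeCongr.right_apply _ _ hx]
      rfl
  · apply Subtype.ext; ext g x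
    simp only [MonoidHom.comp_apply, MonoidHom.prod_apply, Perm.subtypeCongrHom_apply,
      MonoidHom.coe_mk, OneHom.coe_mk, Perm.subtypePerm_apply]
    rw [Perm.subtypeCongr.right_apply _ _ x.2]

/-- The stabilizer of a point under a permutation action. -/
def pointStabilizer {α : Type*} (u : OpenStabHom G α × α) : Subgroup G where
  carrier := {g | u.1.1 g u.2 = u.2}
  mul_mem' := fun {a b} ha hb => by
    simp only [Set.mem_ofPred_eq] at ha hb ⊢
    rw [map_mul, Perm.mul_apply, hb, ha]
  one_mem' := by simp
  inv_mem' := fun {a} ha => by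
    simp only [Set.mem_ofPred_eq] at ha ⊢
    rw [map_inv, Perm.inv_eq_iff_eq, ha]

theorem mem_pointStabilizer {α : Type*} (u : OpenStabHom G α × α) (g : G) :
    g ∈ pointStabilizer u ↔ u.1.1 g u.2 = u.2 := Iff.rfl

theorem isOpen_pointStabilizer {α : Type*} (u : OpenStabHom G α × α) :
    IsOpen (pointStabilizer u : Set G) := u.1.2 u.2

/-- The orbit map of a point, on the cosets of its stabilizer. -/
def orbitEmbedding {α : Type*} (u : OpenStabHom G α × α) : G ⧸ pointStabilizer u ↪ α where
  toFun := Quotient.lift (fun g => u.1.1 g u.2) fun a b hab => by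
    have h : a⁻¹ * b ∈ pointStabilizer u := QuotientGroup.leftRel_apply.1 hab
    rw [mem_pointStabilizer, map_mul, Perm.mul_apply, map_inv, Perm.inv_eq_iff_eq] at h
    exact h.symm
  inj' := by
    intro x y
    induction x using QuotientGroup.induction_on with | H a => ?_
    induction y using QuotientGroup.induction_on with | H b => ?_
    intro (h : u.1.1 a u.2 = u.1.1 b u.2)
    rw [QuotientGroup.eq, mem_pointStabilizer, map_mul, Perm.mul_apply, map_inv,
      Perm.inv_eq_iff_eq]
    exact h.symm

theorem orbitEmbedding_mk {α : Type*} (u : OpenStabHom G α × α) (g : G) :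
    orbitEmbedding u (g : G ⧸ pointStabilizer u) = u.1.1 g u.2 := rfl

/-- A point with stabilizer H is the same as an equivariant embedding of G/H: the embedding is the
orbit map, and the point is the image of the trivial coset. -/
theorem card_pointStabilizer_eq {α : Type*} (H : Subgroup G) :
    Nat.card {u : OpenStabHom G α × α // pointStabilizer u = H} =
      Nat.card (Σ j : G ⧸ H ↪ α, {φ : OpenStabHom G α // ExtendsCosets j φ}) := by
  symm
  have hval : ∀ (j : G ⧸ H ↪ α) (φ : OpenStabHom G α), ExtendsCosets j φ → ∀ g : G,
      φ.1 g (j ((1 : G) : G ⧸ H)) = j (g : G ⧸ H) := by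
    intro j φ h g
    rw [h g]
    congr 1
    exact congrArg _ (mul_one g)
  refine Nat.card_eq_of_bijective
    (fun v => ⟨(v.2.1, v.1 ((1 : G) : G ⧸ H)), ?_⟩) ⟨?_, ?_⟩
  · ext g
    rw [mem_pointStabilizer, hval _ _ v.2.2, v.1.injective.eq_iff, eq_comm, QuotientGroup.eq]
    simp
  · rintro ⟨j, φ, h⟩ ⟨j', φ', h'⟩ heq
    simp only [Subtype.mk.injEq, Prod.mk.injEq] at heq
    obtain ⟨rfl, h1⟩ := heq
    have : j = j' := by
      ext q
      induction q using QuotientGroup.induction_on with | H a => ?_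
      rw [← hval j φ h, ← hval j' φ h', h1]
    subst this
    rfl
  · rintro ⟨u, rfl⟩
    refine ⟨⟨orbitEmbedding u, u.1, fun g q => ?_⟩, ?_⟩
    · induction q using QuotientGroup.induction_on with | H a => ?_
      change _ = orbitEmbedding u ((g * a : G) : G ⧸ pointStabilizer u)
      rw [orbitEmbedding_mk, orbitEmbedding_mk, map_mul, Perm.mul_apply]
    · apply Subtype.ext
      refine Prod.ext rfl ?_
      simp [orbitEmbedding_mk]

/-- A continuous map to a discrete group is determined on a dense subgroup, hence a homomorphism by
its values on the finite generating set. -/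
theorem finite_openStabHom [IsTopologicalGroup G] (hG : IsTopologicallyFG G)
    (α : Type*) [Finite α] : Finite (OpenStabHom G α) := by
  obtain ⟨S, hS⟩ := hG
  refine Finite.of_injective (β := S → Perm α) (fun φ s => φ.1 s) ?_
  intro φ ψ h
  let _ : TopologicalSpace (Perm α) := ⊥
  have : DiscreteTopology (Perm α) := ⟨rfl⟩
  have hc (φ : OpenStabHom G α) : Continuous φ.1 :=
    (continuous_bot_iff_isOpen_stabilizers φ.1).2 φ.2
  apply Subtype.ext
  apply DFunLike.coe_injective
  refine Continuous.ext_on hS (hc φ) (hc ψ) ?_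
  exact MonoidHom.eqOn_closure (fun s hs => congrFun h ⟨s, hs⟩)

theorem card_openStabHom_eq_ncard [IsTopologicalGroup G] (n : ℕ) :
    Nat.card (OpenStabHom G (Fin n)) = (contHomSym G n).ncard := by
  rw [← Nat.card_coe_set_eq]
  exact Nat.card_congr (Equiv.subtypeEquivRight fun φ =>
    (continuous_bot_iff_isOpen_stabilizers φ).symm)

theorem finite_contHomSym [IsTopologicalGroup G] (hG : IsTopologicallyFG G) (n : ℕ) :
    (contHomSym G n).Finite := by
  have := finite_openStabHom hG (Fin n)
  exact (Set.finite_range (fun φ : OpenStabHom G (Fin n) => φ.1)).subset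
    fun φ hφ => ⟨⟨φ, (continuous_bot_iff_isOpen_stabilizers φ).1 hφ⟩, rfl⟩

theorem card_extendsCosets_fin [IsTopologicalGroup G] {n : ℕ} {H : Subgroup G}
    (hH : IsOpen (H : Set G)) (hi : H.index ≠ 0) (j : G ⧸ H ↪ Fin n) :
    Nat.card {φ : OpenStabHom G (Fin n) // ExtendsCosets j φ} =
      Nat.card (OpenStabHom G (Fin (n - H.index))) := by
  classical
  rw [card_extendsCosets hH]
  have : H.FiniteIndex := ⟨hi⟩
  refine card_openStabHom_congr (Finite.equivFinOfCardEq ?_)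
  have := Fintype.ofFinite (G ⧸ H)
  rw [Nat.card_eq_fintype_card, Fintype.card_subtype_compl, Fintype.card_fin]
  congr 1
  rw [← Nat.card_eq_fintype_card, Subgroup.index]
  exact (Nat.card_congr (Equiv.ofInjective j j.injective)).symm

theorem card_pointStabilizer_eq_descFactorial [IsTopologicalGroup G] (hG : IsTopologicallyFG G)
    {n : ℕ} {H : Subgroup G} (hH : IsOpen (H : Set G)) (hi : H.index ≠ 0) :
    Nat.card {u : OpenStabHom G (Fin n) × Fin n // pointStabilizer u = H} =
      n.descFactorial H.index * Nat.card (OpenStabHom G (Fin (n - H.index))) := by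
  classical
  have : H.FiniteIndex := ⟨hi⟩
  have := Fintype.ofFinite (G ⧸ H)
  have := finite_openStabHom hG (Fin n)
  have (j : G ⧸ H ↪ Fin n) : Finite {φ : OpenStabHom G (Fin n) // ExtendsCosets j φ} :=
    Subtype.finite
  rw [card_pointStabilizer_eq, Nat.card_sigma]
  simp only [card_extendsCosets_fin hH hi]
  rw [Finset.sum_const, Finset.card_univ, Fintype.card_embedding_eq, Fintype.card_fin,
    ← Nat.card_eq_fintype_card, smul_eq_mul]
  rfl

theorem index_pointStabilizer_mem {n : ℕ} (u : OpenStabHom G (Fin n) × Fin n) :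
    (pointStabilizer u).index ∈ Finset.Icc 1 n := by
  have := Finite.of_injective _ (orbitEmbedding u).injective
  rw [Finset.mem_Icc]
  refine ⟨Nat.pos_of_ne_zero ?_, ?_⟩
  · exact Nat.card_ne_zero.2 ⟨inferInstance, inferInstance⟩
  · have := Nat.card_le_card_of_injective _ (orbitEmbedding u).injective
    rwa [Nat.card_fin] at this

theorem finite_openSubgroupsOfIndex [IsTopologicalGroup G] (hG : IsTopologicallyFG G)
    {n : ℕ} (hn : 0 < n) : (openSubgroupsOfIndex G n).Finite := by
  have := finite_openStabHom hG (Fin n)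
  refine (Set.finite_range (pointStabilizer : OpenStabHom G (Fin n) × Fin n → _)).subset ?_
  rintro H ⟨hH, hi⟩
  by_contra hcon
  have h0 : IsEmpty {u : OpenStabHom G (Fin n) × Fin n // pointStabilizer u = H} :=
    ⟨fun u => hcon ⟨u.1, u.2⟩⟩
  -- The number of pairs with stabilizer H is n! · h(0), which is nonzero, so every such H occurs
  -- among finitely many point stabilizers.
  have h1 := card_pointStabilizer_eq_descFactorial hG (n := n) hH (by omega)
  rw [Nat.card_of_isEmpty, hi, Nat.sub_self, Nat.descFactorial_self] at h1
  have := finite_openStabHom hG (Fin 0)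
  have : Nonempty (OpenStabHom G (Fin 0)) := ⟨⟨1, fun x => x.elim0⟩⟩
  have h2 : Nat.card (OpenStabHom G (Fin 0)) ≠ 0 := Nat.card_ne_zero.2 ⟨this, inferInstance⟩
  exact mul_ne_zero n.factorial_ne_zero h2 h1.symm

theorem mul_ncard_contHomSym [IsTopologicalGroup G] (hG : IsTopologicallyFG G) (n : ℕ) :
    n * (contHomSym G n).ncard = ∑ d ∈ Finset.Icc 1 n,
      (openSubgroupsOfIndex G d).ncard * (n.descFactorial d * (contHomSym G (n - d)).ncard) := by
  classical
  have := finite_openStabHom hG (Fin n)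
  have := Fintype.ofFinite (OpenStabHom G (Fin n))
  simp only [← card_openStabHom_eq_ncard]
  calc n * Nat.card (OpenStabHom G (Fin n))
      = (Finset.univ : Finset (OpenStabHom G (Fin n) × Fin n)).card := by
        simp [Nat.card_eq_fintype_card, mul_comm]
    _ = ∑ d ∈ Finset.Icc 1 n, (Finset.univ.filter
          fun u : OpenStabHom G (Fin n) × Fin n => (pointStabilizer u).index = d).card :=
        Finset.card_eq_sum_card_fiberwise fun u _ => index_pointStabilizer_mem u
    _ = _ := by
        refine Finset.sum_congr rfl fun d hd => ?_
        have hd1 : 0 < d := (Finset.mem_Icc.1 hd).1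
        have hfin := finite_openSubgroupsOfIndex hG hd1
        rw [Finset.card_eq_sum_card_fiberwise (f := pointStabilizer) (t := hfin.toFinset),
          Set.ncard_eq_toFinset_card _ hfin, ← smul_eq_mul, ← Finset.sum_const]
        · refine Finset.sum_congr rfl fun H hH => ?_
          obtain ⟨hO, rfl⟩ := hfin.mem_toFinset.1 hH
          rw [← card_pointStabilizer_eq_descFactorial hG hO hd1.ne', Nat.card_eq_fintype_card,
            Fintype.card_subtype, Finset.filter_filter]
          congr 1
          ext u
          simp only [Finset.mem_filter, Finset.mem_univ, true_and]
          exact ⟨fun h => h.2, fun h => ⟨by rw [h], h⟩⟩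
        · intro u hu
          simp only [Finset.coe_filter, Finset.mem_univ, true_and, Set.mem_ofPred_eq] at hu
          exact hfin.mem_toFinset.2 ⟨isOpen_pointStabilizer u, hu⟩

theorem ncard_contHomSym_zero [IsTopologicalGroup G] : (contHomSym G 0).ncard = 1 := by
  rw [← card_openStabHom_eq_ncard, Nat.card_eq_one_iff_unique]
  exact ⟨⟨fun a b => Subtype.ext (MonoidHom.ext fun g => Subsingleton.elim _ _)⟩,
    ⟨⟨1, fun x => x.elim0⟩⟩⟩

theorem ncard_openSubgroupsOfIndex_one : (openSubgroupsOfIndex G 1).ncard = 1 := by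
  rw [Set.ncard_eq_one]
  refine ⟨⊤, Set.ext fun H => ?_⟩
  simp only [openSubgroupsOfIndex, Set.mem_ofPred_eq, Subgroup.index_eq_one, Set.mem_singleton_iff]
  exact ⟨fun h => h.2, fun h => ⟨by simp [h], h⟩⟩

end OpenStabHom

end OpenStabilizers

/-! ### Logarithmic derivatives and p-adic growth of exponential series. -/

section ExponentialSeries

open PowerSeries Filter Topology

section LogDeriv

variable {K : Type*} [Field K]

/-- `f` has constant coefficient `1` and logarithmic derivative `X f' / f = a`. -/
def HasLogDeriv (f a : K⟦X⟧) : Prop :=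
  X * d⁄dX K f = a * f ∧ constantCoeff f = 1

theorem coeff_X_mul_derivative (f : K⟦X⟧) (n : ℕ) :
    coeff n (X * d⁄dX K f) = n * coeff n f := by
  cases n with
  | zero => simp
  | succ n => rw [coeff_succ_X_mul, coeff_derivative, mul_comm]; push_cast; rfl

theorem HasLogDeriv.one : HasLogDeriv (1 : K⟦X⟧) 0 := by
  simp [HasLogDeriv]

theorem HasLogDeriv.mul {f g a b : K⟦X⟧} (hf : HasLogDeriv f a) (hg : HasLogDeriv g b) :
    HasLogDeriv (f * g) (a + b) := by
  refine ⟨?_, by rw [map_mul, hf.2, hg.2, one_mul]⟩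
  rw [Derivation.leibniz, smul_eq_mul, smul_eq_mul]
  linear_combination g * hf.1 + f * hg.1

theorem HasLogDeriv.inv {f a : K⟦X⟧} (hf : HasLogDeriv f a) : HasLogDeriv f⁻¹ (-a) := by
  have h1 : f * f⁻¹ = 1 := PowerSeries.mul_inv_cancel f (by rw [hf.2]; exact one_ne_zero)
  refine ⟨?_, by rw [constantCoeff_inv, hf.2, inv_one]⟩
  rw [derivative_inv']
  linear_combination (-f⁻¹ ^ 2) * hf.1 - a * f⁻¹ * h1

theorem HasLogDeriv.prod {ι : Type*} (s : Finset ι) {f a : ι → K⟦X⟧}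
    (h : ∀ i ∈ s, HasLogDeriv (f i) (a i)) : HasLogDeriv (∏ i ∈ s, f i) (∑ i ∈ s, a i) := by
  classical
  induction s using Finset.induction_on with
  | empty => simpa using HasLogDeriv.one
  | insert i s hi ih =>
    rw [Finset.prod_insert hi, Finset.sum_insert hi]
    exact (h i (Finset.mem_insert_self i s)).mul
      (ih fun j hj => h j (Finset.mem_insert_of_mem hj))

/-- Comparing coefficients in X f' = a f expresses n f_n through earlier f_i, because a has no
constant term. The truncation at N allows an infinite product of exponentials to be replaced by a
finite one. -/
theorem HasLogDeriv.coeff_eq [CharZero K] {f g a b : K⟦X⟧} (hf : HasLogDeriv f a)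
    (hg : HasLogDeriv g b) (ha : constantCoeff a = 0) {N : ℕ}
    (h : ∀ n ≤ N, coeff n a = coeff n b) : ∀ n ≤ N, coeff n f = coeff n g := by
  intro n
  induction n using Nat.strong_induction_on with
  | _ n ih =>
    intro hn
    rcases Nat.eq_zero_or_pos n with rfl | hpos
    · rw [coeff_zero_eq_constantCoeff_apply, coeff_zero_eq_constantCoeff_apply, hf.2, hg.2]
    have h1 := congrArg (coeff n) hf.1
    have h2 := congrArg (coeff n) hg.1
    rw [coeff_X_mul_derivative, coeff_mul] at h1 h2
    refine mul_left_cancel₀ (Nat.cast_ne_zero.2 hpos.ne' : (n : K) ≠ 0) ?_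
    rw [h1, h2]
    refine Finset.sum_congr rfl fun x hx => ?_
    have hx := Finset.HasAntidiagonal.mem_antidiagonal.1 hx
    rw [← h x.1 (by omega)]
    rcases Nat.eq_zero_or_pos x.1 with h0 | h0
    · rw [h0, coeff_zero_eq_constantCoeff_apply, ha, zero_mul, zero_mul]
    · rw [ih x.2 (by omega) (by omega)]

theorem HasLogDeriv.unique [CharZero K] {f g a : K⟦X⟧} (hf : HasLogDeriv f a)
    (hg : HasLogDeriv g a) (ha : constantCoeff a = 0) : f = g :=
  PowerSeries.ext fun n => hf.coeff_eq hg ha (fun _ _ => rfl) n le_rfl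

/-- The power series `exp (t X ^ d / d)`. -/
noncomputable def expMonomial (d : ℕ) (t : K) : K⟦X⟧ :=
  mk fun k => if d ∣ k then t ^ (k / d) / ((k / d).factorial * (d : K) ^ (k / d)) else 0

theorem coeff_expMonomial_mul {d : ℕ} (hd : 0 < d) (t : K) (m : ℕ) :
    coeff (d * m) (expMonomial d t) = t ^ m / (m.factorial * (d : K) ^ m) := by
  rw [expMonomial, coeff_mk, if_pos (dvd_mul_right d m), Nat.mul_div_cancel_left m hd]

theorem coeff_expMonomial_of_not_dvd {d k : ℕ} (t : K) (h : ¬ d ∣ k) :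
    coeff k (expMonomial d t) = 0 := by
  rw [expMonomial, coeff_mk, if_neg h]

theorem hasLogDeriv_expMonomial [CharZero K] {d : ℕ} (hd : 0 < d) (t : K) :
    HasLogDeriv (expMonomial d t) (C t * X ^ d) := by
  have hd0 : (d : K) ≠ 0 := Nat.cast_ne_zero.2 hd.ne'
  constructor
  · ext n
    rw [coeff_X_mul_derivative, mul_assoc, coeff_C_mul, coeff_X_pow_mul']
    by_cases hn : d ∣ n
    · obtain ⟨m, rfl⟩ := hn
      cases m with
      | zero => simp [hd.ne']
      | succ m =>
        rw [if_pos (Nat.le_mul_of_pos_right d m.succ_pos),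
          show d * (m + 1) - d = d * m by rw [mul_add, mul_one, Nat.add_sub_cancel],
          coeff_expMonomial_mul hd, coeff_expMonomial_mul hd, Nat.factorial_succ]
        have h1 : ((m : K) + 1) ≠ 0 := by exact_mod_cast m.succ_ne_zero
        have h2 : (m.factorial : K) ≠ 0 := Nat.cast_ne_zero.2 m.factorial_ne_zero
        push_cast
        field_simp
        ring
    · rw [coeff_expMonomial_of_not_dvd t hn, mul_zero]
      split_ifs with h
      · rw [coeff_expMonomial_of_not_dvd t, mul_zero]
        rwa [Nat.dvd_sub_iff_left h dvd_rfl]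
      · rw [mul_zero]
  · rw [← coeff_zero_eq_constantCoeff_apply]
    have := coeff_expMonomial_mul hd t 0
    simpa using this

/-- The coefficients of `f` as an exponential generating function. -/
noncomputable def egfCoeff (f : K⟦X⟧) (n : ℕ) : K := n.factorial * coeff n f

theorem egfCoeff_mul [CharZero K] (f g : K⟦X⟧) (n : ℕ) :
    egfCoeff (f * g) n = ∑ x ∈ Finset.HasAntidiagonal.antidiagonal n,
      n.choose x.1 * egfCoeff f x.1 * egfCoeff g x.2 := by
  rw [egfCoeff, coeff_mul, Finset.mul_sum]
  refine Finset.sum_congr rfl fun x hx => ?_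
  have hx := Finset.HasAntidiagonal.mem_antidiagonal.1 hx
  have h := Nat.choose_mul_factorial_mul_factorial (show x.1 ≤ n by omega)
  rw [show n - x.1 = x.2 by omega] at h
  rw [egfCoeff, egfCoeff, ← h]
  push_cast
  ring

theorem egfCoeff_expMonomial_one [CharZero K] (t : K) (n : ℕ) :
    egfCoeff (expMonomial 1 t) n = t ^ n := by
  have h := coeff_expMonomial_mul one_pos t n
  rw [one_mul] at h
  have h2 : (n.factorial : K) ≠ 0 := Nat.cast_ne_zero.2 n.factorial_ne_zero
  rw [egfCoeff, h, Nat.cast_one, one_pow, mul_one, mul_div_cancel₀ _ h2]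

theorem expMonomial_neg_mul [CharZero K] {d : ℕ} (hd : 0 < d) (t : K) :
    expMonomial d (-t) * expMonomial d t = 1 := by
  have h := (hasLogDeriv_expMonomial hd (-t)).mul (hasLogDeriv_expMonomial hd t)
  rw [map_neg, neg_mul, neg_add_cancel] at h
  exact h.unique HasLogDeriv.one (map_zero _)

end LogDeriv

section Padic

variable {p : ℕ} [hp : Fact p.Prime]

/-- This compares exponents of q in the coefficient bound for exp(t X^d/d). Equality holds at p = 2,
d = 4, v = 2, and the inequality fails at d = p, v = 1, the exceptional index of the theorem. -/
theorem four_add_mul_le {d v : ℕ} (hd : 2 ≤ d) (hdp : d ≠ p) (hv : p ^ v ∣ d) :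
    4 + 4 * (p - 1) * v ≤ 3 * d := by
  have h2 := hp.out.two_le
  obtain ⟨e, rfl⟩ := hv
  obtain ⟨q, rfl⟩ : ∃ q, p = q + 2 := ⟨p - 2, by omega⟩
  rw [show q + 2 - 1 = q + 1 by omega]
  have he : 0 < e := by
    rcases Nat.eq_zero_or_pos e with rfl | h
    · simp at hd
    · exact h
  match v with
  | 0 => simp at hd ⊢; omega
  | 1 =>
    have : 2 ≤ e := by
      by_contra h
      obtain rfl : e = 1 := by omega
      simp at hdp
    nlinarith
  | v + 2 =>
    have key : ∀ v : ℕ, 4 + 4 * (q + 1) * (v + 2) ≤ 3 * (q + 2) ^ (v + 2) := by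
      intro v
      induction v with
      | zero => simp only [Nat.zero_add]; nlinarith
      | succ v ih =>
        have h3 := Nat.mul_le_mul_left (q + 2) ih
        have h4 : 0 ≤ q * (q + 1) * v + q := Nat.zero_le _
        rw [show v + 1 + 2 = v + 2 + 1 by ring, pow_succ]
        nlinarith
    exact (key v).trans (Nat.mul_le_mul_left 3 (Nat.le_mul_of_pos_right _ he))

theorem Padic.norm_natCast_inv {n : ℕ} (hn : n ≠ 0) :
    ‖(n : ℚ_[p])‖⁻¹ = (p : ℝ) ^ padicValNat p n := by
  rw [Padic.norm_eq_zpow_neg_valuation (Nat.cast_ne_zero.2 hn), Padic.valuation_natCast,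
    zpow_neg, inv_inv, zpow_natCast]

-- By Legendre's formula 1/|k!| is at most q^(4k) and nearly attains it. Coefficients bounded by
-- q^(3k) thus leave a factor of about q^(-k) to spare.
variable (p) in
theorem exists_one_lt_pow_eq_prime : ∃ q : ℝ, 1 < q ∧ q ^ (4 * (p - 1)) = p := by
  have h1 : 4 * (p - 1) ≠ 0 := by have := hp.out.two_le; omega
  refine ⟨(p : ℝ) ^ (((4 * (p - 1) : ℕ) : ℝ)⁻¹), ?_, ?_⟩
  · exact Real.one_lt_rpow (by exact_mod_cast hp.out.one_lt) (by positivity)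
  · exact Real.rpow_inv_natCast_pow (Nat.cast_nonneg p) h1

variable {q : ℝ} (hq : 1 < q) (hqp : q ^ (4 * (p - 1)) = p)
include hq hqp

theorem norm_coeff_expMonomial_le {d : ℕ} (hd : 2 ≤ d) {t : ℚ_[p]} (ht : ‖t‖ ≤ 1)
    (htp : d = p → ‖t‖ ≤ (p : ℝ)⁻¹) (k : ℕ) :
    ‖coeff k (expMonomial d t)‖ ≤ (q ^ 3) ^ k := by
  have hq0 : 0 < q := by linarith
  by_cases hk : d ∣ k
  swap
  · rw [coeff_expMonomial_of_not_dvd t hk, norm_zero]; positivity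
  obtain ⟨m, rfl⟩ := hk
  have hfac : ‖(m.factorial : ℚ_[p])‖⁻¹ ≤ (q ^ 4) ^ m := by
    rw [Padic.norm_natCast_inv m.factorial_ne_zero, ← hqp, ← pow_mul, ← pow_mul]
    refine pow_le_pow_right₀ hq.le ?_
    rw [mul_assoc, sub_one_mul_padicValNat_factorial]
    omega
  have hbase : q ^ 4 * (‖t‖ * ‖(d : ℚ_[p])‖⁻¹) ≤ (q ^ 3) ^ d := by
    rw [← pow_mul]
    by_cases hdp : d = p
    -- At d = p the divisibility of t absorbs the denominator.
    · have : ‖t‖ * ‖(d : ℚ_[p])‖⁻¹ ≤ 1 := by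
        have hp0 : (0 : ℝ) < p := by exact_mod_cast hp.out.pos
        rw [hdp, Padic.norm_p, inv_inv]
        calc ‖t‖ * p ≤ (p : ℝ)⁻¹ * p := by gcongr; exact htp hdp
          _ = 1 := inv_mul_cancel₀ hp0.ne'
      calc _ ≤ q ^ 4 * 1 := by gcongr
        _ ≤ _ := by rw [mul_one]; exact pow_le_pow_right₀ hq.le (by omega)
    · rw [Padic.norm_natCast_inv (by omega : d ≠ 0), ← hqp, ← pow_mul]
      calc _ ≤ q ^ 4 * (1 * q ^ (4 * (p - 1) * padicValNat p d)) := by gcongr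
        _ = q ^ (4 + 4 * (p - 1) * padicValNat p d) := by rw [one_mul, pow_add]
        _ ≤ _ := pow_le_pow_right₀ hq.le (four_add_mul_le hd hdp pow_padicValNat_dvd)
  rw [coeff_expMonomial_mul (by omega), norm_div, norm_mul, norm_pow, norm_pow]
  calc _ = ‖(m.factorial : ℚ_[p])‖⁻¹ * (‖t‖ * ‖(d : ℚ_[p])‖⁻¹) ^ m := by
        rw [mul_pow, inv_pow, div_eq_mul_inv, mul_inv]; ring
    _ ≤ (q ^ 4) ^ m * (‖t‖ * ‖(d : ℚ_[p])‖⁻¹) ^ m := by gcongr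
    _ = (q ^ 4 * (‖t‖ * ‖(d : ℚ_[p])‖⁻¹)) ^ m := (mul_pow _ _ _).symm
    _ ≤ ((q ^ 3) ^ d) ^ m := by gcongr
    _ = _ := (pow_mul _ _ _).symm

/-- The base-p digit sum of k is only logarithmic in k, so Legendre's formula gives |k!| q^(4k) ≤
pk, and k q^(-k) tends to 0. -/
theorem tendsto_norm_factorial_mul_pow :
    Tendsto (fun k : ℕ => ‖(k.factorial : ℚ_[p])‖ * (q ^ 3) ^ k) atTop (𝓝 0) := by
  have hq0 : 0 < q := by linarith
  have hp0 : (0 : ℝ) < p := by exact_mod_cast hp.out.pos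
  have hlim : Tendsto (fun k : ℕ => (p : ℝ) * ((k : ℝ) ^ 1 * (q⁻¹) ^ k)) atTop (𝓝 0) := by
    rw [← mul_zero (p : ℝ)]
    refine (tendsto_pow_const_mul_const_pow_of_abs_lt_one 1 ?_).const_mul _
    rw [abs_of_pos (by positivity)]
    exact inv_lt_one_of_one_lt₀ hq
  refine squeeze_zero' (Eventually.of_forall fun k => by positivity) ?_ hlim
  filter_upwards [eventually_ge_atTop 1] with k hk
  have hdig : (p.digits k).sum ≤ (p - 1) * (Nat.log p k + 1) := by
    rw [← Nat.length_digits p k hp.out.one_lt (by omega), mul_comm, ← smul_eq_mul]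
    refine List.sum_le_card_nsmul _ _ fun x hx => ?_
    have := Nat.digits_lt_base hp.out.one_lt hx
    omega
  have hleg : k ≤ (p - 1) * padicValNat p k.factorial + (p - 1) * (Nat.log p k + 1) := by
    rw [sub_one_mul_padicValNat_factorial]; omega
  have hpow : (q ^ 4) ^ k ≤ ‖(k.factorial : ℚ_[p])‖⁻¹ * (p * k) := by
    calc (q ^ 4) ^ k = q ^ (4 * k) := (pow_mul _ _ _).symm
      _ ≤ q ^ (4 * (p - 1) * padicValNat p k.factorial + 4 * (p - 1) * (Nat.log p k + 1)) :=
        pow_le_pow_right₀ hq.le (by rw [mul_assoc, mul_assoc]; omega)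
      _ = ‖(k.factorial : ℚ_[p])‖⁻¹ * (p * (p : ℝ) ^ Nat.log p k) := by
        rw [pow_add, pow_mul _ (4 * (p - 1)), pow_mul _ (4 * (p - 1)), hqp,
          Padic.norm_natCast_inv k.factorial_ne_zero, pow_succ']
      _ ≤ _ := by
        gcongr
        exact_mod_cast Nat.pow_log_le_self p (by omega)
  have hf : 0 < ‖(k.factorial : ℚ_[p])‖ :=
    norm_pos_iff.2 (Nat.cast_ne_zero.2 k.factorial_ne_zero)
  calc ‖(k.factorial : ℚ_[p])‖ * (q ^ 3) ^ k
      = ‖(k.factorial : ℚ_[p])‖ * (q ^ 4) ^ k * (q⁻¹) ^ k := by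
        rw [mul_assoc, ← mul_pow]; congr 2; field_simp
    _ ≤ ‖(k.factorial : ℚ_[p])‖ * (‖(k.factorial : ℚ_[p])‖⁻¹ * (p * k)) * (q⁻¹) ^ k := by gcongr
    _ = _ := by rw [mul_inv_cancel_left₀ hf.ne', pow_one, mul_assoc]

omit hqp hp in
theorem norm_coeff_prod_le [Fact p.Prime] {ι : Type*} (s : Finset ι) {f : ι → ℚ_[p]⟦X⟧}
    (h : ∀ i ∈ s, ∀ k, ‖coeff k (f i)‖ ≤ (q ^ 3) ^ k) (k : ℕ) :
    ‖coeff k (∏ i ∈ s, f i)‖ ≤ (q ^ 3) ^ k := by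
  classical
  have hq0 : 0 < q := by linarith
  induction s using Finset.induction_on generalizing k with
  | empty =>
    rw [Finset.prod_empty, coeff_one]
    split_ifs with hk
    · simp [hk]
    · rw [norm_zero]; positivity
  | insert i s hi ih =>
    rw [Finset.prod_insert hi, coeff_mul]
    refine IsUltrametricDist.norm_sum_le_of_forall_le_of_nonneg (by positivity) fun x hx => ?_
    rw [norm_mul, ← Finset.HasAntidiagonal.mem_antidiagonal.1 hx, pow_add]
    gcongr
    · exact h i (Finset.mem_insert_self i s) _
    · exact ih (fun j hj => h j (Finset.mem_insert_of_mem hj)) _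

end Padic

end ExponentialSeries

/-! ### Mahler expansions and the divisibility criterion. -/

section MahlerCriterion

open PowerSeries Filter Topology PadicInt

section Criterion

variable {p : ℕ} [hp : Fact p.Prime]

instance : IsBoundedSMul ℤ_[p] ℚ_[p] :=
  IsBoundedSMul.of_norm_smul_le fun a x => by
    rw [Algebra.smul_def, norm_mul]
    rfl

theorem HasLogDeriv.tendsto_egfCoeff {f : ℚ_[p]⟦X⟧} {c : ℕ → ℤ}
    (hf : HasLogDeriv f (PowerSeries.mk fun n => (c n : ℚ_[p]))) (h0 : c 0 = 0) (h1 : c 1 = 0)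
    (hcp : (p : ℤ) ∣ c p) : Tendsto (egfCoeff f) atTop (𝓝 0) := by
  obtain ⟨q, hq, hqp⟩ := exists_one_lt_pow_eq_prime p
  have hbound (k : ℕ) : ‖coeff k f‖ ≤ (q ^ 3) ^ k := by
    have hprod : HasLogDeriv (∏ d ∈ Finset.Icc 2 k, expMonomial d (c d : ℚ_[p]))
        (∑ d ∈ Finset.Icc 2 k, C (c d : ℚ_[p]) * X ^ d) :=
      HasLogDeriv.prod _ fun d hd =>
        hasLogDeriv_expMonomial (by have := (Finset.mem_Icc.1 hd).1; omega) _
    -- Up to degree k, f agrees with the finite product of the factors 2 ≤ d ≤ k.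
    rw [hf.coeff_eq hprod (N := k) (by simp [← coeff_zero_eq_constantCoeff_apply, h0]) ?_ k le_rfl]
    · refine norm_coeff_prod_le hq _ (fun d hd => ?_) k
      refine norm_coeff_expMonomial_le hq hqp (Finset.mem_Icc.1 hd).1
        (Padic.norm_int_le_one _) ?_
      rintro rfl
      have := (Padic.norm_int_le_pow_iff_dvd (p := d) (c d) 1).2 (by simpa using hcp)
      simpa using this
    · intro n hn
      simp only [coeff_mk, map_sum, coeff_C_mul, coeff_X_pow, mul_ite, mul_one, mul_zero,
        Finset.sum_ite_eq, Finset.mem_Icc]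
      split_ifs with h
      · rfl
      · obtain rfl | rfl : n = 0 ∨ n = 1 := by omega
        · simp [h0]
        · simp [h1]
  refine squeeze_zero_norm (fun k => ?_) (tendsto_norm_factorial_mul_pow hq hqp)
  rw [egfCoeff, norm_mul]
  gcongr
  exact hbound k

/-- Binomial coefficients have p-adic norm at most 1, so the binomial convolution of two null
sequences is null by the ultrametric inequality. -/
theorem tendsto_egfCoeff_mul {f g : ℚ_[p]⟦X⟧} (hf : Tendsto (egfCoeff f) atTop (𝓝 0))
    (hg : Tendsto (egfCoeff g) atTop (𝓝 0)) : Tendsto (egfCoeff (f * g)) atTop (𝓝 0) := by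
  obtain ⟨M, hM⟩ := hf.norm.bddAbove_range
  obtain ⟨M', hM'⟩ := hg.norm.bddAbove_range
  have hfM (n : ℕ) : ‖egfCoeff f n‖ ≤ max M M' := (hM ⟨n, rfl⟩).trans (le_max_left _ _)
  have hgM (n : ℕ) : ‖egfCoeff g n‖ ≤ max M M' := (hM' ⟨n, rfl⟩).trans (le_max_right _ _)
  set B := max M M'
  have hB : 0 ≤ B := (norm_nonneg _).trans (hfM 0)
  rw [Metric.tendsto_atTop] at hf hg ⊢
  intro ε hε
  obtain ⟨N, hN⟩ := hf (ε / (2 * (B + 1))) (by positivity)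
  obtain ⟨N', hN'⟩ := hg (ε / (2 * (B + 1))) (by positivity)
  refine ⟨N + N', fun n hn => ?_⟩
  rw [dist_zero_right, egfCoeff_mul]
  have hsmall : ε / (2 * (B + 1)) * B ≤ ε / 2 := by
    rw [div_mul_eq_mul_div, div_le_div_iff₀ (by positivity) two_pos]
    nlinarith
  refine lt_of_le_of_lt (IsUltrametricDist.norm_sum_le_of_forall_le_of_nonneg
    (C := ε / 2) (by positivity) fun x hx => ?_) (half_lt_self hε)
  have hx := Finset.HasAntidiagonal.mem_antidiagonal.1 hx
  have hc : ‖(n.choose x.1 : ℚ_[p])‖ ≤ 1 := by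
    simpa using Padic.norm_int_le_one (p := p) (n.choose x.1 : ℤ)
  rw [norm_mul, norm_mul]
  calc _ ≤ 1 * ‖egfCoeff f x.1‖ * ‖egfCoeff g x.2‖ := by gcongr
    _ = ‖egfCoeff f x.1‖ * ‖egfCoeff g x.2‖ := by rw [one_mul]
    _ ≤ ε / (2 * (B + 1)) * B := by
      rcases (by omega : N ≤ x.1 ∨ N' ≤ x.2) with h | h
      · have := (hN _ h).le
        rw [dist_zero_right] at this
        gcongr
        exact hgM _
      · have := (hN' _ h).le
        rw [dist_zero_right] at this
        rw [mul_comm]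
        gcongr
        exact hfM _
    _ ≤ ε / 2 := hsmall

/-- Multiplication by e^X is the binomial transform, which turns Mahler coefficients into values. -/
theorem egfCoeff_mul_exp {f : ℚ_[p]⟦X⟧} (hf : Tendsto (egfCoeff f) atTop (𝓝 0)) (n : ℕ) :
    egfCoeff (f * expMonomial 1 1) n = mahlerSeries (egfCoeff f) (n : ℤ_[p]) := by
  rw [mahlerSeries_apply_nat hf le_rfl, egfCoeff_mul,
    Finset.Nat.sum_antidiagonal_eq_sum_range_succ_mk]
  refine Finset.sum_congr rfl fun i _ => ?_
  rw [egfCoeff_expMonomial_one, one_pow, mul_one, nsmul_eq_mul]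

theorem egfCoeff_mul_exp_neg {f : ℚ_[p]⟦X⟧}
    (hf : Tendsto (fun k => (-1) ^ k * egfCoeff f k) atTop (𝓝 0)) (n : ℕ) :
    egfCoeff (f * expMonomial 1 (-1)) n =
      (-1) ^ n * mahlerSeries (fun k => (-1) ^ k * egfCoeff f k) (n : ℤ_[p]) := by
  rw [mahlerSeries_apply_nat hf le_rfl, egfCoeff_mul,
    Finset.Nat.sum_antidiagonal_eq_sum_range_succ_mk, Finset.mul_sum]
  refine Finset.sum_congr rfl fun i hi => ?_
  have hi : i ≤ n := Nat.lt_succ_iff.1 (Finset.mem_range.1 hi)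
  obtain ⟨m, rfl⟩ := Nat.exists_eq_add_of_le hi
  have h1 : ((-1 : ℚ_[p]) ^ i) * (-1) ^ i = 1 := by rw [← mul_pow]; simp
  rw [egfCoeff_expMonomial_one, nsmul_eq_mul, Nat.add_sub_cancel_left, pow_add]
  linear_combination (-((i + m).choose i : ℚ_[p]) * egfCoeff f i * (-1) ^ m) * h1

/-- The coefficient is t^m (pm)!/(m! p^m), and (pm)! has exactly m more factors p than m!. -/
theorem norm_egfCoeff_expMonomial_prime {t : ℚ_[p]} (ht : ‖t‖ = 1) (m : ℕ) :
    ‖egfCoeff (expMonomial p t) (p * m)‖ = 1 := by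
  have hp0 : (0 : ℝ) < p := by exact_mod_cast hp.out.pos
  have h1 := Padic.norm_natCast_inv (p := p) (p * m).factorial_ne_zero
  have h2 := Padic.norm_natCast_inv (p := p) m.factorial_ne_zero
  rw [padicValNat_factorial_mul, pow_add, ← h2] at h1
  rw [egfCoeff, coeff_expMonomial_mul hp.out.pos, norm_mul, norm_div, norm_mul, norm_pow,
    norm_pow, ht, Padic.norm_p, ← inv_inv ‖((p * m).factorial : ℚ_[p])‖, h1]
  have h3 : ‖(m.factorial : ℚ_[p])‖ ≠ 0 :=
    norm_ne_zero_iff.2 (Nat.cast_ne_zero.2 m.factorial_ne_zero)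
  field_simp
  simp

theorem hasLogDeriv_of_recurrence {K : Type*} [Field K] [CharZero K] {s h : ℕ → ℕ} (h0 : h 0 = 1)
    (hrec : ∀ n, n * h n = ∑ d ∈ Finset.Icc 1 n, s d * (n.descFactorial d * h (n - d))) :
    HasLogDeriv (PowerSeries.mk fun n => (h n : K) / n.factorial)
      (PowerSeries.mk fun n => if n = 0 then 0 else (s n : K)) := by
  constructor
  · ext n
    rw [coeff_X_mul_derivative, coeff_mk, coeff_mul,
      Finset.Nat.sum_antidiagonal_eq_sum_range_succ_mk, ← mul_div_assoc]
    have hcast := congrArg (Nat.cast : ℕ → K) (hrec n)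
    push_cast at hcast
    rw [hcast, Finset.sum_div, Finset.range_eq_Ico, Finset.sum_eq_sum_Ico_succ_bot n.succ_pos]
    simp only [coeff_mk, if_true, zero_mul, zero_add]
    refine Finset.sum_congr (by ext; simp) fun d hd => ?_
    have hd := Finset.mem_Ico.1 hd
    rw [if_neg (by omega)]
    have hf := Nat.factorial_mul_descFactorial (show d ≤ n by omega)
    have h1 : (n.factorial : K) ≠ 0 := Nat.cast_ne_zero.2 n.factorial_ne_zero
    have h2 : ((n - d).factorial : K) ≠ 0 := Nat.cast_ne_zero.2 (n - d).factorial_ne_zero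
    rw [mul_div_assoc, div_eq_div_iff h1 h2 |>.2 ?_]
    rw [← hf]
    push_cast
    ring
  · simp [← coeff_zero_eq_constantCoeff_apply, h0]

theorem extendsToPadic_iff_of_recurrence {s h : ℕ → ℕ} (h0 : h 0 = 1) (s1 : s 1 = 1)
    (hrec : ∀ n, n * h n = ∑ d ∈ Finset.Icc 1 n, s d * (n.descFactorial d * h (n - d))) :
    ExtendsToPadic p h ↔ p ∣ s p := by
  have hH := hasLogDeriv_of_recurrence (K := ℚ_[p]) h0 hrec
  set H : ℚ_[p]⟦X⟧ := PowerSeries.mk fun n => (h n : ℚ_[p]) / n.factorial with hHdef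
  have hHegf (n : ℕ) : egfCoeff H n = h n := by
    rw [egfCoeff, coeff_mk, mul_div_cancel₀ _ (Nat.cast_ne_zero.2 n.factorial_ne_zero)]
  have hexp : expMonomial 1 (-1 : ℚ_[p]) * expMonomial 1 1 = 1 := expMonomial_neg_mul one_pos 1
  have hA := hH.mul (hasLogDeriv_expMonomial one_pos (-1 : ℚ_[p]))
  constructor
  · rintro ⟨F, hF, hFh⟩
    by_contra hdvd
    -- D keeps the factors of H with d ≠ 1, p. Its inverse then satisfies the decay criterion with
    -- coefficient 0 at p.
    have hD := hA.mul (hasLogDeriv_expMonomial hp.out.pos (-(s p : ℚ_[p])))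
    set D := H * expMonomial 1 (-1) * expMonomial p (-(s p : ℚ_[p])) with hDdef
    let c : ℕ → ℤ := fun n =>
      -((if n = 0 then 0 else (s n : ℤ)) - (if n = 1 then 1 else 0) - (if n = p then s p else 0))
    have hDinv : HasLogDeriv D⁻¹ (PowerSeries.mk fun n => (c n : ℚ_[p])) := by
      convert hD.inv using 1
      ext n
      simp only [c, coeff_mk, map_neg, map_add, coeff_C_mul, coeff_X_pow, neg_mul, map_one,
        one_mul]
      split_ifs <;> push_cast <;> ring
    have hc0 : c 0 = 0 := by simp [c, hp.out.ne_zero.symm]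
    have hc1 : c 1 = 0 := by simp [c, s1, hp.out.ne_one.symm]
    have hcp : c p = 0 := by simp [c, hp.out.ne_zero, hp.out.ne_one]
    have hw := hDinv.tendsto_egfCoeff hc0 hc1 (by rw [hcp]; exact dvd_zero _)
    have hw' : Tendsto (fun k => (-1) ^ k * egfCoeff D⁻¹ k) atTop (𝓝 0) := by
      rw [tendsto_zero_iff_norm_tendsto_zero] at hw ⊢
      simpa using hw
    let Fc : C(ℤ_[p], ℚ_[p]) := ⟨F, hF⟩
    let b : ℕ → ℚ_[p] := fun k => (fwdDiff (1 : ℤ_[p]))^[k] Fc 0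
    have hb : Tendsto b atTop (𝓝 0) := fwdDiff_tendsto_zero Fc
    let B : ℚ_[p]⟦X⟧ := PowerSeries.mk fun k => b k / k.factorial
    have hBegf : egfCoeff B = b := by
      ext n
      rw [egfCoeff, coeff_mk, mul_div_cancel₀ _ (Nat.cast_ne_zero.2 n.factorial_ne_zero)]
    have hB : Tendsto (egfCoeff B) atTop (𝓝 0) := by rwa [hBegf]
    have hBF (n : ℕ) : egfCoeff (B * expMonomial 1 1) n = F n := by
      rw [egfCoeff_mul_exp hB, hBegf]
      have := (hasSum_mahler Fc).unique (hasSum_mahlerSeries hb)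
      exact (DFunLike.congr_fun this (n : ℤ_[p])).symm
    -- The possible discrepancy at 0 between h and its extension.
    set δ : ℚ_[p] := 1 - F 0
    have hHB : H = B * expMonomial 1 1 + C δ := by
      ext n
      refine mul_left_cancel₀ (Nat.cast_ne_zero.2 n.factorial_ne_zero : (n.factorial : ℚ_[p]) ≠ 0) ?_
      rw [map_add, mul_add]
      change egfCoeff H n = egfCoeff (B * expMonomial 1 1) n + _
      rw [hHegf, hBF, coeff_C]
      rcases Nat.eq_zero_or_pos n with rfl | hn
      · simp [h0, δ]
      · rw [hFh n hn, if_neg hn.ne', mul_zero, add_zero]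
    have hDD : D * D⁻¹ = 1 := PowerSeries.mul_inv_cancel D (by rw [hD.2]; exact one_ne_zero)
    have hE : expMonomial p (s p : ℚ_[p]) = B * D⁻¹ + C δ * (D⁻¹ * expMonomial 1 (-1)) := by
      have hpp := expMonomial_neg_mul hp.out.pos (s p : ℚ_[p])
      calc expMonomial p (s p : ℚ_[p]) = H * expMonomial 1 (-1) * D⁻¹ := by
            rw [hDdef] at hDD ⊢
            linear_combination (-expMonomial p (s p : ℚ_[p])) * hDD +
              (H * expMonomial 1 (-1) * (H * expMonomial 1 (-1) *
                expMonomial p (-(s p : ℚ_[p])))⁻¹) * hpp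
        _ = _ := by rw [hHB]; linear_combination (B * D⁻¹) * hexp
    let W := mahlerSeries (p := p) fun k => (-1) ^ k * egfCoeff D⁻¹ k
    have hEegf (k : ℕ) : egfCoeff (expMonomial p (s p : ℚ_[p])) k =
        egfCoeff (B * D⁻¹) k + δ * ((-1) ^ k * W k) := by
      rw [← egfCoeff_mul_exp_neg hw', hE, egfCoeff, egfCoeff, egfCoeff, map_add, coeff_C_mul]
      ring
    have hy := tendsto_egfCoeff_mul hB hw
    -- D⁻¹ has no linear term, since its logarithmic derivative starts in degree at least 2.
    have hW1 : W 1 = 1 := by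
      have hcoeff := hDinv.coeff_eq HasLogDeriv.one (N := 1)
        (by simp [← coeff_zero_eq_constantCoeff_apply, hc0]) (fun n hn => by
          obtain rfl | rfl : n = 0 ∨ n = 1 := by omega
          · simp [hc0]
          · simp [hc1])
      have := mahlerSeries_apply_nat (p := p) hw' (le_refl 1)
      rw [Nat.cast_one] at this
      rw [this]
      simp [Finset.sum_range_succ, egfCoeff, hcoeff 0 (by omega), hcoeff 1 le_rfl, coeff_one]
    -- Along k = 1 + p^(j+1), prime to p, the series in X^p has zero coefficient, so δ W(k) tends to
    -- 0. These k tend p-adically to 1, so ‖δ W(k)‖ also tends to ‖δ W(1)‖ = ‖δ‖.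
    have hδ : δ = 0 := by
      have hk : Tendsto (fun j : ℕ => 1 + p ^ (j + 1)) atTop atTop :=
        tendsto_atTop_mono (fun j => Nat.le_add_left _ 1)
          ((tendsto_pow_atTop_atTop_of_one_lt hp.out.one_lt).comp (tendsto_add_atTop_nat 1))
      have hlim1 : Tendsto (fun j : ℕ => ‖δ‖ * ‖W ((1 + p ^ (j + 1) : ℕ) : ℤ_[p])‖) atTop
          (𝓝 0) := by
        have h3 := (hy.comp hk).norm
        rw [norm_zero] at h3
        refine h3.congr fun j => ?_
        have h4 := hEegf (1 + p ^ (j + 1))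
        rw [egfCoeff, coeff_expMonomial_of_not_dvd, mul_zero] at h4
        · rw [Function.comp_apply, eq_neg_of_add_eq_zero_left h4.symm]
          simp
        · intro hd
          rw [Nat.dvd_add_left (dvd_pow_self p j.succ_ne_zero)] at hd
          exact hp.out.one_lt.ne' (Nat.dvd_one.1 hd)
      have hlim2 : Tendsto (fun j : ℕ => ‖δ‖ * ‖W ((1 + p ^ (j + 1) : ℕ) : ℤ_[p])‖) atTop
          (𝓝 (‖δ‖ * 1)) := by
        refine Tendsto.const_mul _ ?_
        have h5 : Tendsto (fun j : ℕ => ((1 + p ^ (j + 1) : ℕ) : ℤ_[p])) atTop (𝓝 1) := by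
          have hpnorm : ‖(p : ℤ_[p])‖ < 1 := by
            rw [PadicInt.norm_p]
            exact inv_lt_one_of_one_lt₀ (by exact_mod_cast hp.out.one_lt)
          have h6 : Tendsto (fun j : ℕ => (p : ℤ_[p]) ^ (j + 1)) atTop (𝓝 0) :=
            (tendsto_pow_atTop_nhds_zero_of_norm_lt_one hpnorm).comp
              (tendsto_add_atTop_nat 1)
          simpa using h6.const_add 1
        have := ((W.continuous.tendsto 1).comp h5).norm
        rwa [hW1, norm_one] at this
      have := tendsto_nhds_unique hlim1 hlim2
      simpa using this.symm
    have hs : ‖(s p : ℚ_[p])‖ = 1 :=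
      Padic.norm_natCast_eq_one_iff.2 ((Nat.Prime.coprime_iff_not_dvd hp.out).2 hdvd)
    -- With δ = 0, the coefficients at multiples of p both tend to 0 and have norm 1.
    have hk : Tendsto (fun m : ℕ => p * m) atTop atTop :=
      tendsto_id.const_mul_atTop' hp.out.pos
    have h7 := (hy.comp hk).norm
    have h8 : (fun m : ℕ => ‖(egfCoeff (B * D⁻¹) ∘ fun m => p * m) m‖) = fun _ => 1 := by
      ext m
      rw [← norm_egfCoeff_expMonomial_prime hs m, hEegf, hδ]
      simp
    rw [h8, norm_zero] at h7
    exact one_ne_zero (tendsto_nhds_unique tendsto_const_nhds h7)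
  · intro hdvd
    let c : ℕ → ℤ := fun n => (if n = 0 then 0 else (s n : ℤ)) - (if n = 1 then 1 else 0)
    have hA' : HasLogDeriv (H * expMonomial 1 (-1))
        (PowerSeries.mk fun n => (c n : ℚ_[p])) := by
      convert hA using 1
      ext n
      simp only [c, coeff_mk, map_add, coeff_C_mul, coeff_X_pow]
      split_ifs <;> push_cast <;> ring
    have ha := hA'.tendsto_egfCoeff (by simp [c]) (by simp [c, s1])
      (by simpa [c, hp.out.ne_zero, hp.out.ne_one] using Int.natCast_dvd_natCast.2 hdvd)
    refine ⟨mahlerSeries (egfCoeff (H * expMonomial 1 (-1))), ContinuousMap.continuous _,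
      fun n _ => ?_⟩
    rw [← egfCoeff_mul_exp ha, mul_assoc, hexp, mul_one, hHegf]

end Criterion

end MahlerCriterion

theorem corollary3p6 (p : ℕ) [Fact p.Prime]
    (G : Type*) [Group G] [TopologicalSpace G] [IsTopologicalGroup G] :
    (IsTopologicallyFG G →
      (∀ n : ℕ, 0 < n → (contHomSym G n).Finite) ∧
      (∀ n : ℕ, 0 < n → (openSubgroupsOfIndex G n).Finite) ∧
      (ExtendsToPadic p (fun n => (contHomSym G n).ncard) ↔
        p ∣ (openSubgroupsOfIndex G p).ncard)) ∧
    (Finite G → (Nat.card G).Coprime p →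
      ExtendsToPadic p (fun n => (contHomSym G n).ncard)) := by
  have key (hG : IsTopologicallyFG G) : ExtendsToPadic p (fun n => (contHomSym G n).ncard) ↔
      p ∣ (openSubgroupsOfIndex G p).ncard :=
    extendsToPadic_iff_of_recurrence (s := fun d => (openSubgroupsOfIndex G d).ncard)
      ncard_contHomSym_zero ncard_openSubgroupsOfIndex_one (mul_ncard_contHomSym hG)
  refine ⟨fun hG => ⟨fun n _ => finite_contHomSym hG n,
    fun n hn => finite_openSubgroupsOfIndex hG hn, key hG⟩, fun hfin hcop => ?_⟩
  have hG : IsTopologicallyFG G := by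
    have := Fintype.ofFinite G
    exact ⟨Finset.univ, by simp⟩
  -- An index divides the group order, so the count in the criterion is 0.
  have hempty : openSubgroupsOfIndex G p = ∅ := by
    refine Set.eq_empty_of_forall_notMem ?_
    rintro H ⟨-, hi⟩
    have hdvd : p ∣ Nat.card G := hi ▸ H.index_dvd_card
    exact (Fact.out : p.Prime).one_lt.ne' (Nat.dvd_one.1 (hcop ▸ Nat.dvd_gcd hdvd dvd_rfl))
  rw [key hG, hempty, Set.ncard_empty]
  exact dvd_zero p
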